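/- Let $D\subset\mathbb{C}$ be a nonempty bounded simply connected (in particular connected) open set that is regular, i.e. $D=\operatorname{Int}(\overline{D})$, and let $\delta>0$. Put $$D^{-\delta}:=\{z\in D:\ \operatorname{dist}(z,\mathbb{C}\setminus D)>\delta\}.$$ Then there exist a transcendental entire function $f:\mathbb{C}\to\mathbb{C}$ and an invariant Fatou component $U$ of $f$ (a connected component $U$ of the Fatou set of $f$ with $f(U)\subseteq U$, i.e. a periodic component of period $1$) such that $$D^{-\delta}\subseteq U\subseteq D.$$ Here the Fatou set of $f$ is the set of points of $\mathbb{C}$ having an open neighbourhood on which the iterates $f^n$, $n\in\mathbb{N}$, form a normal family with respect to the spherical metric, and "transcendental entire" means holomorphic on $\mathbb{C}$ and not a polynomial. -/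

import Mathlib

open Set Filter Topology

noncomputable section

/-- Locally uniform convergence on `W ⊆ ℂ` of a sequence of maps into the Riemann sphere
`OnePoint ℂ`. The sphere is compact Hausdorff, so it carries exactly one uniform structure
compatible with its topology (the one of the spherical, equivalently the chordal, metric), and
convergence is meant with respect to that structure. -/
def SphericallyTendstoLocallyUniformlyOn (u : ℕ → ℂ → OnePoint ℂ) (g : ℂ → OnePoint ℂ)
    (W : Set ℂ) : Prop :=
  letI : UniformSpace (OnePoint ℂ) := uniformSpaceOfCompactR1
  TendstoLocallyUniformlyOn u g atTop W

/-- A family `F` of maps into the Riemann sphere is normal on `W` if every sequence of members of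
`F` has a subsequence that converges locally uniformly on `W` in the spherical metric. -/
def IsNormalFamilyOn (F : Set (ℂ → OnePoint ℂ)) (W : Set ℂ) : Prop :=
  ∀ u : ℕ → ℂ → OnePoint ℂ, (∀ n, u n ∈ F) →
    ∃ φ : ℕ → ℕ, StrictMono φ ∧ ∃ g : ℂ → OnePoint ℂ,
      SphericallyTendstoLocallyUniformlyOn (fun k => u (φ k)) g W

/-- The family of iterates `f^n` of `f : ℂ → ℂ`, viewed as maps into the Riemann sphere. -/
def iterateFamily (f : ℂ → ℂ) : Set (ℂ → OnePoint ℂ) :=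
  range fun n : ℕ => fun z : ℂ => ((f^[n] z : ℂ) : OnePoint ℂ)

/-- The Fatou set of `f : ℂ → ℂ`: the points of the plane with an open neighbourhood on which the
iterates of `f` form a normal family. -/
def fatouSet (f : ℂ → ℂ) : Set ℂ :=
  {z | ∃ W : Set ℂ, IsOpen W ∧ z ∈ W ∧ IsNormalFamilyOn (iterateFamily f) W}

/-- A Fatou component of `f` is a connected component of its Fatou set. -/
def IsFatouComponent (f : ℂ → ℂ) (U : Set ℂ) : Prop :=
  ∃ z ∈ fatouSet f, U = connectedComponentIn (fatouSet f) z

/-- A Fatou component `U` of `f` is invariant (that is, periodic of period `1`) if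
`f(U) ⊆ U`. -/
def IsInvariantFatouComponent (f : ℂ → ℂ) (U : Set ℂ) : Prop :=
  IsFatouComponent f U ∧ MapsTo f U U

/-- A transcendental entire function: holomorphic on the whole plane and not a polynomial. -/
def IsTranscendentalEntire (f : ℂ → ℂ) : Prop :=
  Differentiable ℂ f ∧ ¬ ∃ p : Polynomial ℂ, ∀ z, f z = p.eval z

/-- The set `D^{-δ}` of points of `D` at distance more than `δ` from the complement of `D`
(used only for `D ≠ ℂ`, so that the complement is nonempty). -/
def innerSet (D : Set ℂ) (δ : ℝ) : Set ℂ :=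
  {z ∈ D | δ < Metric.infDist z Dᶜ}

end

/-!
The function sought is a small perturbation of a polynomial with a strongly attracting fixed point
`p ∈ D`. Choose a connected compact set `K ⊆ D` containing the inner set and a disc of radius `ρ`
about `p`, and a bounded open set `G ⊇ K` with `closure G ⊆ D`. If an entire `f` fixes `p`, maps
`K` deep into the disc and maps the boundary of `G` off `closure G`, then the immediate basin `U`
of `p` satisfies `K ⊆ U ⊆ G`: the component `V` at `p` of the set of points that reach the disc
without leaving `G` is relatively closed in `U`, since orbits of boundary points of `V` stay in
`closure G` and never meet the boundary of `G` (`exists_isInvariantFatouComponent`).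

Such an `f` is `p + η (q - q p) + τ (exp - exp p)` with small `η`, `τ` and a polynomial `q` bounded
by `1` on `K` and huge on the boundary of `G`; the exponential term makes it transcendental. The
polynomial `q` is a normalised Fekete polynomial (`exists_polynomial_norm_le_one_and_le_norm`,
Hilbert's lemniscate theorem), which exists once the boundary of `G` avoids the polynomial hull of
`K`. That `G` can be chosen around the hull is where simple connectivity enters: the hull of `K`
adds only holes of `K` (`isOpen_polynomialHull_diff`, by pole pushing), and a simply connected `D`
contains these, because `log (z - z₀)` has a continuous branch on `D` for `z₀ ∉ D`
(`polynomialHull_subset_of_isSimplyConnected`).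
-/

/-! ### Polynomial hulls -/

/-- The polynomially convex hull of a set `K ⊆ ℂ`, for compact `K`: the points at which no
polynomial is larger in modulus than everywhere on `K`. -/
def polynomialHull (K : Set ℂ) : Set ℂ :=
  {z | ∀ p : Polynomial ℂ, ∃ w ∈ K, ‖p.eval z‖ ≤ ‖p.eval w‖}

lemma notMem_polynomialHull {K : Set ℂ} {z : ℂ} :
    z ∉ polynomialHull K ↔ ∃ p : Polynomial ℂ, ∀ w ∈ K, ‖p.eval w‖ < ‖p.eval z‖ := by
  simp [polynomialHull]

lemma subset_polynomialHull (K : Set ℂ) : K ⊆ polynomialHull K :=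
  fun z hz _ => ⟨z, hz, le_rfl⟩

lemma exists_eval_eq_one_of_notMem_polynomialHull {K : Set ℂ} (hK : IsCompact K) {z : ℂ}
    (hz : z ∉ polynomialHull K) {ε : ℝ} (hε : 0 < ε) :
    ∃ p : Polynomial ℂ, p.eval z = 1 ∧ ∀ w ∈ K, ‖p.eval w‖ < ε := by
  obtain ⟨p, hp⟩ := notMem_polynomialHull.1 hz
  rcases K.eq_empty_or_nonempty with rfl | hne
  · exact ⟨1, by simp, by simp⟩
  obtain ⟨w₀, hw₀, hmax⟩ := hK.exists_isMaxOn hne (f := fun w => ‖p.eval w‖) (by fun_prop)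
  have hpz : 0 < ‖p.eval z‖ := (norm_nonneg _).trans_lt (hp w₀ hw₀)
  have hc : ‖p.eval w₀‖ / ‖p.eval z‖ < 1 := (div_lt_one hpz).2 (hp w₀ hw₀)
  obtain ⟨n, hn⟩ := exists_pow_lt_of_lt_one hε hc
  refine ⟨Polynomial.C ((p.eval z)⁻¹ ^ n) * p ^ n, ?_, fun w hw => ?_⟩
  · have : p.eval z ≠ 0 := norm_pos_iff.1 hpz
    simp [this]
  · refine lt_of_le_of_lt ?_ hn
    have : ‖p.eval w‖ ≤ ‖p.eval w₀‖ := hmax hw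
    simp only [Polynomial.eval_mul, Polynomial.eval_C, Polynomial.eval_pow, norm_mul, norm_pow,
      norm_inv, ← mul_pow]
    rw [div_eq_inv_mul]
    gcongr

lemma isClosed_polynomialHull {K : Set ℂ} (hK : IsCompact K) : IsClosed (polynomialHull K) := by
  rw [← isOpen_compl_iff, isOpen_iff_mem_nhds]
  intro z hz
  obtain ⟨p, hp1, hp⟩ := exists_eval_eq_one_of_notMem_polynomialHull hK hz one_half_pos
  have : ∀ᶠ y in 𝓝 z, 1 / 2 < ‖p.eval y‖ := by
    have hc : ContinuousAt (fun y => ‖p.eval y‖) z := by fun_prop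
    exact hc.eventually_const_lt (by simp only [hp1]; norm_num)
  filter_upwards [this] with y hy
  exact notMem_polynomialHull.2 ⟨p, fun w hw => (hp w hw).trans hy⟩

lemma isCompact_polynomialHull {K : Set ℂ} (hK : IsCompact K) : IsCompact (polynomialHull K) := by
  refine Metric.isCompact_of_isClosed_isBounded (isClosed_polynomialHull hK) ?_
  obtain ⟨R, hR⟩ := hK.isBounded.exists_norm_le
  refine isBounded_iff_forall_norm_le.2 ⟨R, fun z hz => ?_⟩
  obtain ⟨w, hw, h⟩ := hz Polynomial.X
  simp only [Polynomial.eval_X] at h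
  exact h.trans (hR w hw)

/-- Pole pushing: if `b` close to `a` lies outside the hull, there is a polynomial `P` with
`P b = 1` that is small on `K`, so `(1 - P) / (X - b)` is a polynomial close to `1 / (X - b)`,
hence to `1 / (X - a)`, on `K`, and then `a` is outside the hull as well. -/
lemma isOpen_polynomialHull_diff {K : Set ℂ} (hK : IsCompact K) :
    IsOpen (polynomialHull K \ K) := by
  rw [Metric.isOpen_iff]
  rintro a ⟨ha, haK⟩
  obtain ⟨r, hr, hball⟩ := Metric.isOpen_iff.1 hK.isClosed.isOpen_compl a haK
  refine ⟨r / 3, by positivity, fun b hb => ⟨?_, hball (Metric.ball_subset_ball (by linarith) hb)⟩⟩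
  by_contra hbH
  obtain ⟨P, hP1, hP⟩ := exists_eval_eq_one_of_notMem_polynomialHull hK hbH (ε := 1 / 3)
    (by norm_num)
  obtain ⟨Q, hQ⟩ : Polynomial.X - Polynomial.C b ∣ 1 - P :=
    Polynomial.dvd_iff_isRoot.2 (by simp [hP1])
  refine notMem_polynomialHull.2 ⟨1 - (Polynomial.X - Polynomial.C a) * Q, fun w hw => ?_⟩ ha
  have hwa : r ≤ ‖w - a‖ := by
    by_contra h
    exact hball (by simpa [dist_eq_norm] using h) hw
  have hba : ‖a - b‖ < r / 3 := by
    rw [norm_sub_rev, ← dist_eq_norm]; exact hb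
  have htri : ‖w - a‖ ≤ ‖w - b‖ + ‖a - b‖ := by
    have := norm_sub_le (w - b) (a - b)
    simpa using this
  have hwb : 2 * r / 3 < ‖w - b‖ := by linarith
  have hev := congrArg (Polynomial.eval w) hQ
  simp only [Polynomial.eval_sub, Polynomial.eval_one, Polynomial.eval_mul, Polynomial.eval_X,
    Polynomial.eval_C] at hev ⊢
  have key : (w - b) * (1 - (w - a) * Q.eval w) = (a - b) + (w - a) * P.eval w := by
    linear_combination (w - a) * hev
  have hn : ‖w - b‖ * ‖1 - (w - a) * Q.eval w‖ ≤ ‖a - b‖ + ‖w - a‖ * (1 / 3) := by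
    rw [← norm_mul, key]
    refine (norm_add_le _ _).trans ?_
    rw [norm_mul]
    gcongr
    exact (hP w hw).le
  simp only [sub_self, zero_mul, sub_zero, norm_one]
  by_contra! hcon
  nlinarith [norm_nonneg (w - b)]

/-! ### Compact sets in simply connected domains -/

/-- There is no continuous branch of `log (z - z₀)` on a circle around `z₀`. -/
lemma not_continuous_log_on_circle (z₀ : ℂ) {R : ℝ} (hR : 0 < R) {H : ℂ → ℂ} (hH : Continuous H)
    (hexp : ∀ z, ‖z - z₀‖ = R → Complex.exp (H z) = z - z₀) : False := by
  set c : ℝ → ℂ := fun θ => z₀ + R * Complex.exp (θ * Complex.I) with hc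
  have hcc : Continuous c := by fun_prop
  have hnorm : ∀ θ, ‖c θ - z₀‖ = R := fun θ => by
    simp [hc, Complex.norm_exp_ofReal_mul_I, abs_of_pos hR]
  have hper : c (2 * Real.pi) = c 0 := by simp [hc]
  -- `k` is continuous and integer valued, with `k 0 = 0` and `k (2π) = -1`.
  set k : ℝ → ℝ := fun θ => ((H (c θ)).im - θ - (H (c 0)).im) / (2 * Real.pi) with hk
  have hkc : Continuous k := by fun_prop
  have hint : ∀ θ, ∃ n : ℤ, k θ = n := by
    intro θ
    have h1 : Complex.exp (H (c θ)) = Complex.exp (H (c 0) + θ * Complex.I) := by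
      rw [Complex.exp_add, hexp _ (hnorm θ), hexp _ (hnorm 0)]
      simp [hc]
    obtain ⟨n, hn⟩ := Complex.exp_eq_exp_iff_exists_int.1 h1
    refine ⟨n, ?_⟩
    have him := congrArg Complex.im hn
    simp at him
    simp only [hk]
    rw [him]
    field_simp
    ring
  have h0 : k 0 = 0 := by simp [hk]
  have h2 : k (2 * Real.pi) = -1 := by
    simp only [hk, hper]
    field_simp
    ring
  obtain ⟨θ, -, hθ⟩ := intermediate_value_Icc' (by positivity : (0 : ℝ) ≤ 2 * Real.pi)
    hkc.continuousOn (show (-1 / 2 : ℝ) ∈ Icc (k (2 * Real.pi)) (k 0) by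
      rw [h0, h2]; constructor <;> norm_num)
  obtain ⟨n, hn⟩ := hint θ
  have h3 : (2 * n : ℝ) = -1 := by rw [← hn, hθ]; norm_num
  have h4 : 2 * n = -1 := by exact_mod_cast h3
  omega

lemma isSimplyConnected_univ_complex : IsSimplyConnected (univ : Set ℂ) :=
  have : ContractibleSpace (univ : Set ℂ) := convex_univ.contractibleSpace univ_nonempty
  SimplyConnectedSpace.ofContractible (univ : Set ℂ)

/-- A simply connected domain has no holes: a continuous branch of `log (z - z₀)` along the
boundary of the hole `O` could be extended over `O` (without regard to `z - z₀`), which would yield a nowhere vanishing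
continuous function on the plane equal to `z - z₀` near infinity. -/
lemma subset_of_frontier_subset_of_isSimplyConnected {D O : Set ℂ} (hD : IsOpen D)
    (hsc : IsSimplyConnected D) (hOb : Bornology.IsBounded O)
    (hfr : frontier O ⊆ D) : O ⊆ D := by
  intro z₀ hz₀
  by_contra hz₀D
  obtain ⟨h, hhc, hh⟩ := Complex.exists_continuousOn_eqOn_exp_comp hsc hD
    (g := fun z => z - z₀) (by fun_prop) (by
      rintro ⟨z, hz, h0⟩
      exact hz₀D (by rwa [← sub_eq_zero.1 h0]))
  obtain ⟨H, hH⟩ := ContinuousMap.exists_restrict_eq (isClosed_frontier (s := O))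
    ⟨(frontier O).domRestrict h, (hhc.mono hfr).domRestrict⟩
  have hHfr : ∀ z ∈ frontier O, Complex.exp (H z) = z - z₀ := by
    intro z hz
    have := congrArg (fun F => F ⟨z, hz⟩) hH
    simp at this
    rw [this]
    exact hh (hfr hz)
  classical
  set F : ℂ → ℂ := O.piecewise (fun z => Complex.exp (H z)) (fun z => z - z₀) with hF
  have hFc : Continuous F := Continuous.piecewise hHfr (by fun_prop) (by fun_prop)
  have hF0 : ∀ z, F z ≠ 0 := by
    intro z
    by_cases hz : z ∈ O
    · simp [hF, hz, Complex.exp_ne_zero]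
    · simp only [hF, Set.piecewise_eq_of_notMem _ _ _ hz]
      intro h0
      exact hz (by rwa [sub_eq_zero.1 h0])
  obtain ⟨g, hgc, hg⟩ := Complex.exists_continuousOn_eqOn_exp_comp
    isSimplyConnected_univ_complex isOpen_univ hFc.continuousOn (by
      rintro ⟨z, -, h0⟩
      exact hF0 z h0)
  obtain ⟨R, hR⟩ := (Metric.isBounded_iff_subset_ball z₀).1 hOb
  have hR0 : 0 < R := by simpa using hR hz₀
  refine not_continuous_log_on_circle z₀ hR0 (continuousOn_univ.1 hgc) fun z hz => ?_
  have hzO : z ∉ O := fun hzO => by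
    have := hR hzO
    rw [Metric.mem_ball, dist_eq_norm] at this
    linarith
  have := hg (mem_univ z)
  simpa [hF, hzO] using this

/-- The part of the hull outside `K` is an open set with boundary in `K`, that is, the holes of
`K`; these are filled by a simply connected domain containing `K`. -/
lemma polynomialHull_subset_of_isSimplyConnected {D K : Set ℂ} (hD : IsOpen D)
    (hsc : IsSimplyConnected D) (hK : IsCompact K) (hKD : K ⊆ D) : polynomialHull K ⊆ D := by
  have hO := isOpen_polynomialHull_diff hK
  have hfr : frontier (polynomialHull K \ K) ⊆ K := by
    intro z hz
    by_contra hzK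
    rw [hO.frontier_eq] at hz
    exact hz.2 ⟨closure_minimal sdiff_subset (isClosed_polynomialHull hK) hz.1, hzK⟩
  have hsub := subset_of_frontier_subset_of_isSimplyConnected hD hsc
    ((isCompact_polynomialHull hK).isBounded.subset sdiff_subset) (hfr.trans hKD)
  intro z hz
  by_cases hzK : z ∈ K
  exacts [hKD hzK, hsub ⟨hz, hzK⟩]

/-! ### Fekete points and polynomial lemniscates -/

/-- The product of the distances between all ordered pairs of distinct points of `S`; it is the
square of the modulus of the Vandermonde determinant of `S`. -/
noncomputable def pairDistProd (S : Finset ℂ) : ℝ := ∏ x ∈ S, ∏ y ∈ S.erase x, dist x y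

lemma pairDistProd_pos (S : Finset ℂ) : 0 < pairDistProd S :=
  Finset.prod_pos fun _ _ => Finset.prod_pos fun _ hy =>
    dist_pos.2 (Finset.ne_of_mem_erase hy).symm

lemma pairDistProd_insert {S : Finset ℂ} {w : ℂ} (hw : w ∉ S) :
    pairDistProd (insert w S) = pairDistProd S * (∏ y ∈ S, dist w y) ^ 2 := by
  have h1 : ∀ x ∈ S, ∏ y ∈ (insert w S).erase x, dist x y
      = dist w x * ∏ y ∈ S.erase x, dist x y := by
    intro x hx
    have hne : w ≠ x := fun h => hw (h ▸ hx)
    rw [Finset.erase_insert_of_ne hne, Finset.prod_insert (fun h => hw (Finset.mem_of_mem_erase h)),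
      dist_comm]
  rw [pairDistProd, Finset.prod_insert hw, Finset.erase_insert hw, Finset.prod_congr rfl h1,
    Finset.prod_mul_distrib, pairDistProd]
  ring

/-- `S` is a set of `n` Fekete points of `K`: an `n`-point subset of `K` whose product of mutual
distances is the largest possible. -/
structure IsFekete (K : Set ℂ) (n : ℕ) (S : Finset ℂ) : Prop where
  subset : (S : Set ℂ) ⊆ K
  card : S.card = n
  le : ∀ T : Finset ℂ, (T : Set ℂ) ⊆ K → T.card = n → pairDistProd T ≤ pairDistProd S

lemma exists_isFekete {K : Set ℂ} (hK : IsCompact K) (hinf : K.Infinite) (n : ℕ) :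
    ∃ S, IsFekete K n S := by
  -- The function maximised on `K ^ n`; it vanishes at tuples with repeated entries.
  set Φ : (Fin n → ℂ) → ℝ := fun z => ∏ i, ∏ j ∈ Finset.univ.erase i, dist (z i) (z j) with hΦ
  have hΦT : ∀ z : Fin n → ℂ, Function.Injective z →
      Φ z = pairDistProd (Finset.univ.image z) := by
    intro z hz
    rw [pairDistProd, Finset.prod_image hz.injOn]
    refine Finset.prod_congr rfl fun i _ => ?_
    rw [← Finset.image_erase hz, Finset.prod_image hz.injOn]
  have hT : ∀ T : Finset ℂ, (T : Set ℂ) ⊆ K → T.card = n →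
      ∃ z : Fin n → ℂ, (∀ i, z i ∈ K) ∧ Φ z = pairDistProd T := by
    intro T hTK hTn
    have e := (T.equivFinOfCardEq hTn).symm
    have hinj : Function.Injective fun i => (e i : ℂ) :=
      Subtype.val_injective.comp e.injective
    refine ⟨fun i => e i, fun i => hTK (e i).2, ?_⟩
    rw [hΦT _ hinj]
    congr 1
    ext x
    simp only [Finset.mem_image, Finset.mem_univ, true_and]
    exact ⟨fun ⟨i, hi⟩ => hi ▸ (e i).2, fun hx => ⟨e.symm ⟨x, hx⟩, by simp⟩⟩
  obtain ⟨T₀, hT₀K, hT₀n⟩ := hinf.exists_subset_card_eq n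
  obtain ⟨z₀, hz₀, hΦ₀⟩ := hT T₀ hT₀K hT₀n
  obtain ⟨z, hz, hmax⟩ := (isCompact_univ_pi fun _ : Fin n => hK).exists_isMaxOn
    ⟨z₀, fun i _ => hz₀ i⟩ (f := Φ) (Continuous.continuousOn (by fun_prop))
  have hmax' : ∀ y : Fin n → ℂ, (∀ i, y i ∈ K) → Φ y ≤ Φ z := fun y hy => hmax fun i _ => hy i
  have hpos : 0 < Φ z := (hΦ₀ ▸ pairDistProd_pos T₀).trans_le (hmax' z₀ hz₀)
  have hinj : Function.Injective z := by
    intro i j hij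
    by_contra hne
    refine hpos.ne' (Finset.prod_eq_zero (Finset.mem_univ i) (Finset.prod_eq_zero
      (Finset.mem_erase.2 ⟨Ne.symm hne, Finset.mem_univ j⟩) (dist_eq_zero.2 hij)))
  refine ⟨Finset.univ.image z, ?_, ?_, fun T hTK hTn => ?_⟩
  · intro x hx
    simp only [Finset.coe_image, Finset.coe_univ, image_univ] at hx
    obtain ⟨i, rfl⟩ := hx
    exact hz i (mem_univ i)
  · simp [Finset.card_image_of_injective _ hinj]
  · obtain ⟨y, hy, hyΦ⟩ := hT T hTK hTn
    rw [← hyΦ, ← hΦT z hinj]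
    exact hmax' y hy

/-- The monic polynomial with simple zeros at the points of `S`. -/
noncomputable def nodalPoly (S : Finset ℂ) : Polynomial ℂ :=
  ∏ y ∈ S, (Polynomial.X - Polynomial.C y)

lemma norm_eval_nodalPoly (S : Finset ℂ) (z : ℂ) :
    ‖(nodalPoly S).eval z‖ = ∏ y ∈ S, dist z y := by
  simp [nodalPoly, Polynomial.eval_prod, dist_eq_norm]

/-- The nodal polynomial of Fekete points is bounded on `K` by the growth of the extremal
products, as appending a point to Fekete points cannot beat Fekete points. -/
lemma IsFekete.norm_eval_le {K : Set ℂ} {n : ℕ} {S T : Finset ℂ} (hS : IsFekete K n S)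
    (hT : IsFekete K (n + 1) T) {w : ℂ} (hw : w ∈ K) :
    ‖(nodalPoly S).eval w‖ ≤ √(pairDistProd T / pairDistProd S) := by
  rw [norm_eval_nodalPoly]
  by_cases hwS : w ∈ S
  · rw [Finset.prod_eq_zero hwS (dist_self w)]
    positivity
  refine Real.le_sqrt_of_sq_le ?_
  rw [le_div_iff₀ (pairDistProd_pos S), mul_comm, ← pairDistProd_insert hwS]
  refine hT.le _ ?_ (by rw [Finset.card_insert_of_notMem hwS, hS.card])
  rw [Finset.coe_insert]
  exact insert_subset hw hS.subset

/-- At each of `n + 1` Fekete points the product of distances to the others is bounded below by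
the growth of the extremal products, as removing a point from Fekete points cannot beat
Fekete points. -/
lemma IsFekete.le_prod_dist {K : Set ℂ} {n : ℕ} {S T : Finset ℂ} (hS : IsFekete K n S)
    (hT : IsFekete K (n + 1) T) {w : ℂ} (hw : w ∈ T) :
    √(pairDistProd T / pairDistProd S) ≤ ∏ y ∈ T.erase w, dist w y := by
  refine Real.sqrt_le_iff.2 ⟨Finset.prod_nonneg fun _ _ => dist_nonneg, ?_⟩
  rw [div_le_iff₀ (pairDistProd_pos S)]
  conv_lhs => rw [← Finset.insert_erase hw]
  rw [pairDistProd_insert (Finset.notMem_erase w T), mul_comm]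
  gcongr
  refine hS.le _ ?_ (by rw [Finset.card_erase_of_mem hw, hT.card]; rfl)
  exact (Finset.coe_subset.2 (Finset.erase_subset w T)).trans hT.subset

/-- The Lagrange interpolation formula bounds polynomials of degree at most `n` at points outside
`K` by the nodal polynomial of `n + 1` Fekete points. -/
lemma IsFekete.norm_eval_le_nodalPoly {K : Set ℂ} {n : ℕ} {S T : Finset ℂ}
    (hS : IsFekete K n S) (hT : IsFekete K (n + 1) T) {p : Polynomial ℂ} (hp : p.natDegree ≤ n)
    (hpK : ∀ w ∈ K, ‖p.eval w‖ ≤ 1) {z : ℂ} {d : ℝ} (hd : 0 < d) (hz : ∀ w ∈ K, d ≤ dist z w) :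
    d * √(pairDistProd T / pairDistProd S) * ‖p.eval z‖
      ≤ (n + 1) * ‖(nodalPoly T).eval z‖ := by
  set r := √(pairDistProd T / pairDistProd S) with hr
  have hr0 : 0 < r := Real.sqrt_pos.2 (div_pos (pairDistProd_pos T) (pairDistProd_pos S))
  have hdeg : p.degree < T.card := by
    rw [hT.card]
    exact (Polynomial.degree_le_of_natDegree_le hp).trans_lt (by exact_mod_cast Nat.lt_succ_self n)
  have hzT : ∀ i ∈ T, z ≠ id i := by
    intro i hi hzi
    have := hz i (hT.subset hi)
    rw [hzi, id, dist_self] at this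
    linarith
  have hint := congrArg (Polynomial.eval z)
    (Lagrange.eq_interpolate (v := id) (s := T) (injOn_id _) hdeg)
  rw [Lagrange.eval_interpolate_not_at_node _ hzT] at hint
  have hnodal : Polynomial.eval z (Lagrange.nodal T id) = (nodalPoly T).eval z := by
    simp [nodalPoly, Lagrange.nodal]
  rw [hnodal] at hint
  have hterm : ∀ i ∈ T, ‖Lagrange.nodalWeight T id i * (z - id i)⁻¹ * p.eval (id i)‖
      ≤ (d * r)⁻¹ := by
    intro i hi
    have h1 : ‖Lagrange.nodalWeight T id i‖ ≤ r⁻¹ := by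
      rw [Lagrange.nodalWeight, Finset.prod_inv_distrib, norm_inv, norm_prod]
      simp only [id, ← dist_eq_norm]
      exact inv_anti₀ hr0 (hS.le_prod_dist hT hi)
    have h2 : ‖(z - id i)⁻¹‖ ≤ d⁻¹ := by
      rw [norm_inv, ← dist_eq_norm]
      exact inv_anti₀ hd (hz i (hT.subset hi))
    have h3 : ‖p.eval (id i)‖ ≤ 1 := hpK i (hT.subset hi)
    rw [norm_mul, norm_mul, mul_inv, mul_comm d⁻¹]
    calc _ ≤ r⁻¹ * d⁻¹ * 1 := by gcongr
      _ = _ := mul_one _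
  have hsum := (norm_sum_le T _).trans (Finset.sum_le_sum hterm)
  rw [Finset.sum_const, hT.card, nsmul_eq_mul] at hsum
  have hdr : 0 < d * r := mul_pos hd hr0
  rw [hint, norm_mul]
  calc d * r * (‖(nodalPoly T).eval z‖ * _)
      ≤ d * r * (‖(nodalPoly T).eval z‖ * (((n + 1 : ℕ) : ℝ) * (d * r)⁻¹)) := by gcongr
    _ = _ := by push_cast; field_simp

/-- By compactness of `L`, the degrees of polynomials separating points of `L` from `K` can be
bounded uniformly. -/
lemma exists_uniform_natDegree_lt_norm_eval {K L : Set ℂ} (hK : IsCompact K)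
    (hL : IsCompact L) (hKL : Disjoint L (polynomialHull K)) :
    ∃ m : ℕ, 0 < m ∧ ∀ z ∈ L, ∃ p : Polynomial ℂ, p.natDegree ≤ m ∧
      (∀ w ∈ K, ‖p.eval w‖ ≤ 1) ∧ 2 < ‖p.eval z‖ := by
  have hloc : ∀ z ∈ L, ∃ p : Polynomial ℂ, (∀ w ∈ K, ‖p.eval w‖ ≤ 1) ∧ 2 < ‖p.eval z‖ := by
    intro z hz
    obtain ⟨p, hp1, hp⟩ := exists_eval_eq_one_of_notMem_polynomialHull hK
      (Set.disjoint_left.1 hKL hz) (ε := 1 / 3) (by norm_num)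
    refine ⟨Polynomial.C 3 * p, fun w hw => ?_, ?_⟩
    · have := hp w hw
      simp only [Polynomial.eval_mul, Polynomial.eval_C, norm_mul, RCLike.norm_ofNat]
      linarith
    · simp [hp1]
      norm_num
  choose! P hPK hPz using hloc
  obtain ⟨t, htL, ht⟩ := hL.elim_nhds_subcover (fun z => {y | 2 < ‖(P z).eval y‖}) fun z hz => by
    have hc : ContinuousAt (fun y => ‖(P z).eval y‖) z := by fun_prop
    exact hc.eventually_const_lt (hPz z hz)
  refine ⟨t.sup (fun z => (P z).natDegree) + 1, Nat.succ_pos _, fun z hz => ?_⟩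
  obtain ⟨y, hyt, hy⟩ := mem_iUnion₂.1 (ht hz)
  exact ⟨P y, (Finset.le_sup (f := fun z => (P z).natDegree) hyt).trans (Nat.le_succ _),
    hPK y (htL y hyt), hy⟩

lemma eventually_mul_le_two_pow_div {m : ℕ} (hm : 0 < m) (A : ℝ) :
    ∀ᶠ n : ℕ in atTop, A * (n + 1) ≤ 2 ^ (n / m) := by
  have hlim : Tendsto (fun k : ℕ => ((k : ℝ) ^ 1 / 2 ^ k + (k : ℝ) ^ 0 / 2 ^ k) * (|A| * m))
      atTop (𝓝 0) := by
    simpa using ((tendsto_pow_const_div_const_pow_of_one_lt 1 (one_lt_two (α := ℝ))).add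
      (tendsto_pow_const_div_const_pow_of_one_lt 0 (one_lt_two (α := ℝ)))).mul_const (|A| * m)
  have hdiv : Tendsto (fun n : ℕ => n / m) atTop atTop := Nat.tendsto_div_const_atTop hm.ne'
  filter_upwards [(hlim.comp hdiv).eventually_lt_const one_pos] with n hn
  simp only [Function.comp, pow_one, pow_zero, ← add_div] at hn
  rw [div_mul_eq_mul_div, div_lt_one (by positivity)] at hn
  have hnm : n + 1 ≤ (n / m + 1) * m := Nat.lt_div_mul_add hm |>.trans_eq (by ring)
  have hnm' : (n : ℝ) + 1 ≤ (((n / m : ℕ) : ℝ) + 1) * m := by exact_mod_cast hnm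
  calc A * (n + 1) ≤ |A| * ((((n / m : ℕ) : ℝ) + 1) * m) := by
        gcongr
        exact le_abs_self A
    _ = (((n / m : ℕ) : ℝ) + 1) * (|A| * m) := by ring
    _ ≤ _ := hn.le

/-- **Hilbert's lemniscate theorem**, in quantitative form. If the ratio of the nodal polynomials
of Fekete points on `L` and on `K` stayed bounded, the extremal products of `K` would grow
faster than the diameter of `K` permits. -/
theorem exists_polynomial_norm_le_one_and_le_norm {K L : Set ℂ} (hK : IsCompact K)
    (hinf : K.Infinite) (hL : IsCompact L) (hKL : Disjoint L (polynomialHull K)) (M : ℝ) :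
    ∃ q : Polynomial ℂ, (∀ w ∈ K, ‖q.eval w‖ ≤ 1) ∧ ∀ z ∈ L, M ≤ ‖q.eval z‖ := by
  by_contra! hno
  obtain ⟨m, hm, hmL⟩ := exists_uniform_natDegree_lt_norm_eval hK hL hKL
  obtain ⟨d, hd, hdKL⟩ := Metric.exists_pos_forall_lt_edist hL hK.isClosed
    (hKL.mono_right (subset_polynomialHull K))
  have hdist : ∀ z ∈ L, ∀ w ∈ K, (d : ℝ) ≤ dist z w := by
    intro z hz w hw
    have := hdKL z hz w hw
    rw [edist_nndist] at this
    exact_mod_cast this.le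
  obtain ⟨C, hC1, hC⟩ : ∃ C : ℝ, 1 ≤ C ∧ ∀ x ∈ K, ∀ y ∈ K, dist x y ≤ C := by
    obtain ⟨C, hC⟩ := Metric.isBounded_iff.1 hK.isBounded
    exact ⟨max C 1, le_max_right _ _, fun x hx y hy => (hC hx hy).trans (le_max_left _ _)⟩
  have hC0 : 0 < C := one_pos.trans_le hC1
  choose S hS using exists_isFekete hK hinf
  set r : ℕ → ℝ := fun n => √(pairDistProd (S (n + 1)) / pairDistProd (S n)) with hr
  have hr0 : ∀ n, 0 < r n := fun n =>
    Real.sqrt_pos.2 (div_pos (pairDistProd_pos _) (pairDistProd_pos _))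
  have hrC : ∀ n, r n ≤ C ^ n := by
    intro n
    obtain ⟨w, hw⟩ : (S (n + 1)).Nonempty := by
      rw [← Finset.card_pos, (hS (n + 1)).card]
      exact Nat.succ_pos n
    refine ((hS n).le_prod_dist (hS (n + 1)) hw).trans ?_
    have hcard : ((S (n + 1)).erase w).card = n := by
      rw [Finset.card_erase_of_mem hw, (hS (n + 1)).card]
      rfl
    have hle : ∏ y ∈ (S (n + 1)).erase w, dist w y ≤ ∏ _y ∈ (S (n + 1)).erase w, C :=
      Finset.prod_le_prod (fun _ _ => dist_nonneg) fun y hy =>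
        hC w ((hS (n + 1)).subset hw) y ((hS (n + 1)).subset (Finset.mem_of_mem_erase hy))
    rwa [Finset.prod_const, hcard] at hle
  -- From some index on, `r` grows by the factor `C + 1`, as otherwise a normalised nodal
  -- polynomial has the required properties.
  obtain ⟨N, hN⟩ := eventually_atTop.1 (eventually_mul_le_two_pow_div hm ((C + 1) * M / d))
  have hstep : ∀ n, N ≤ n → (C + 1) * r n ≤ r (n + 1) := by
    intro n hn
    by_contra! hlt
    set F := nodalPoly (S (n + 1)) with hF
    have hev : ∀ z, ‖(Polynomial.C ((r (n + 1) : ℂ)⁻¹) * F).eval z‖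
        = ‖F.eval z‖ / r (n + 1) := by
      intro z
      simp only [Polynomial.eval_mul, Polynomial.eval_C, norm_mul, norm_inv, Complex.norm_real,
        Real.norm_eq_abs, abs_of_pos (hr0 (n + 1))]
      rw [div_eq_inv_mul]
    obtain ⟨z, hz, hzM⟩ := hno (Polynomial.C ((r (n + 1) : ℂ)⁻¹) * F) fun w hw => by
      rw [hev, div_le_one (hr0 _)]
      exact (hS (n + 1)).norm_eval_le (hS (n + 2)) hw
    rw [hev, div_lt_iff₀ (hr0 _)] at hzM
    obtain ⟨p, hpm, hpK, hpz⟩ := hmL z hz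
    have hlag := (hS n).norm_eval_le_nodalPoly (hS (n + 1)) (p := p ^ (n / m))
      ((Polynomial.natDegree_pow_le).trans
        ((Nat.mul_le_mul_left _ hpm).trans (Nat.div_mul_le_self n m)))
      (fun w hw => by
        rw [Polynomial.eval_pow, norm_pow]
        exact pow_le_one₀ (norm_nonneg _) (hpK w hw))
      (z := z) (NNReal.coe_pos.2 hd) (hdist z hz)
    rw [Polynomial.eval_pow, norm_pow] at hlag
    have hd' : (0 : ℝ) < d := NNReal.coe_pos.2 hd
    have h1 : (C + 1) * M / d * (n + 1) ≤ ‖p.eval z‖ ^ (n / m) :=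
      (hN n hn).trans (by gcongr)
    have h2 : d * r n * ((C + 1) * M / d * (n + 1)) ≤ (n + 1) * ‖F.eval z‖ :=
      le_trans (mul_le_mul_of_nonneg_left h1 (mul_pos hd' (hr0 n)).le) hlag
    have h3 : d * r n * ((C + 1) * M / d * (n + 1)) = (n + 1) * (M * ((C + 1) * r n)) := by
      field_simp
    rw [h3] at h2
    have h4 : M * ((C + 1) * r n) ≤ ‖F.eval z‖ := le_of_mul_le_mul_left h2 (by positivity)
    have h5 : M * ((C + 1) * r n) < M * r (n + 1) := h4.trans_lt hzM
    have hM : 0 < M := by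
      by_contra! hM
      have : M * r (n + 1) ≤ 0 := mul_nonpos_of_nonpos_of_nonneg hM (hr0 _).le
      linarith [norm_nonneg (F.eval z)]
    exact absurd (lt_of_mul_lt_mul_left h5 hM.le) hlt.le.not_gt
  have hgrow : ∀ k, (C + 1) ^ k * r N ≤ r (N + k) := by
    intro k
    induction k with
    | zero => simp
    | succ k ih =>
      calc (C + 1) ^ (k + 1) * r N = (C + 1) * ((C + 1) ^ k * r N) := by ring
        _ ≤ (C + 1) * r (N + k) := by gcongr
        _ ≤ r (N + k + 1) := hstep _ (Nat.le_add_right N k)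
  obtain ⟨k, hk⟩ := pow_unbounded_of_one_lt (C ^ N / r N)
    ((one_lt_div hC0).2 (lt_add_one C))
  have h1 := (hgrow k).trans (hrC (N + k))
  rw [div_pow, div_lt_div_iff₀ (hr0 N) (by positivity), ← pow_add] at hk
  linarith

/-! ### Basins of attraction and Fatou components -/

section Dynamics

variable {f : ℂ → ℂ} {p : ℂ} {ρ : ℝ}

/-- In a disc on which `f` halves distances to the centre `p`, iterates converge to `p`
geometrically. -/
lemma dist_iterate_le (hf : ∀ z ∈ Metric.ball p ρ, dist (f z) p ≤ 1 / 2 * dist z p)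
    {z : ℂ} (hz : z ∈ Metric.ball p ρ) (n : ℕ) :
    f^[n] z ∈ Metric.ball p ρ ∧ dist (f^[n] z) p ≤ (1 / 2) ^ n * ρ := by
  have hz' : dist z p < ρ := hz
  induction n with
  | zero => simpa using ⟨hz', hz'.le⟩
  | succ n ih =>
    obtain ⟨hb, hd⟩ := ih
    have hstep := hf _ hb
    rw [Function.iterate_succ_apply', Metric.mem_ball, pow_succ]
    have hb' : dist (f^[n] z) p < ρ := hb
    have h0 : 0 ≤ dist (f^[n] z) p := dist_nonneg
    constructor <;> nlinarith

lemma tendsto_iterate_of_iterate_mem_ball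
    (hf : ∀ z ∈ Metric.ball p ρ, dist (f z) p ≤ 1 / 2 * dist z p) {W : Set ℂ} (hW : IsOpen W)
    {k : ℕ} (hk : MapsTo f^[k] W (Metric.ball p ρ)) {x : ℂ} (hx : x ∈ W) :
    Tendsto (fun y : ℕ × ℂ => f^[y.1] y.2) (atTop ×ˢ 𝓝 x) (𝓝 p) := by
  have hlim : Tendsto (fun y : ℕ × ℂ => (1 / 2 : ℝ) ^ (y.1 - k) * ρ) (atTop ×ˢ 𝓝 x) (𝓝 0) := by
    have h := ((tendsto_pow_atTop_nhds_zero_of_lt_one (r := (1 / 2 : ℝ)) (by norm_num)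
      (by norm_num)).comp (tendsto_sub_atTop_nat k)).mul_const ρ
    rw [zero_mul] at h
    exact h.comp tendsto_fst
  rw [tendsto_iff_dist_tendsto_zero]
  refine squeeze_zero' (Eventually.of_forall fun _ => dist_nonneg) ?_ hlim
  filter_upwards [(eventually_ge_atTop k).prod_mk (hW.mem_nhds hx)] with y hy
  have := (dist_iterate_le hf (hk hy.2) (y.1 - k)).2
  rwa [← Function.iterate_add_apply, Nat.sub_add_cancel hy.1] at this

lemma subset_fatouSet_of_mapsTo_ball
    (hf : ∀ z ∈ Metric.ball p ρ, dist (f z) p ≤ 1 / 2 * dist z p) {W : Set ℂ} (hW : IsOpen W)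
    {k : ℕ} (hk : MapsTo f^[k] W (Metric.ball p ρ)) : W ⊆ fatouSet f := by
  intro z hz
  refine ⟨W, hW, hz, fun u hu => ?_⟩
  choose m hm using hu
  let _ : UniformSpace (OnePoint ℂ) := uniformSpaceOfCompactR1
  -- Either one iterate occurs infinitely often, or the exponents tend to infinity.
  by_cases hfreq : ∃ l, ∃ᶠ n in atTop, m n = l
  · obtain ⟨l, hl⟩ := hfreq
    obtain ⟨φ, hφ, hφl⟩ := extraction_of_frequently_atTop hl
    refine ⟨φ, hφ, fun z => ((f^[l] z : ℂ) : OnePoint ℂ), ?_⟩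
    have hconst : ∀ n, u (φ n) = fun z => ((f^[l] z : ℂ) : OnePoint ℂ) := fun n => by
      rw [← hm, hφl]
    intro s hs x _
    refine ⟨univ, univ_mem, Eventually.of_forall fun n y _ => ?_⟩
    simp only [hconst]
    exact refl_mem_uniformity hs
  · push Not at hfreq
    have hmt : Tendsto m atTop atTop := by
      have h : Tendsto m atTop cofinite := le_cofinite_iff_eventually_ne.2 fun l => hfreq l
      rwa [Nat.cofinite_eq_atTop] at h
    refine ⟨id, strictMono_id, fun _ => (p : OnePoint ℂ), ?_⟩
    refine (hW.tendstoLocallyUniformlyOn_iff_forall_tendsto).2 fun x hx => ?_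
    refine Uniform.tendsto_nhds_right.1 ?_
    have h1 := (OnePoint.continuous_coe.tendsto p).comp
      ((tendsto_iterate_of_iterate_mem_ball hf hW hk hx).comp (hmt.prodMap tendsto_id))
    refine h1.congr fun y => ?_
    simp [← hm]

/-- The basin of `p` is relatively closed in the Fatou set: at a boundary point of the basin, a
limit of a subsequence of the iterates takes the value `p` by continuity. -/
lemma exists_iterate_mem_ball_of_mem_fatouSet (hfc : Continuous f) (hρ : 0 < ρ)
    (hf : ∀ z ∈ Metric.ball p ρ, dist (f z) p ≤ 1 / 2 * dist z p) {z : ℂ} (hz : z ∈ fatouSet f)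
    (hcl : z ∈ closure {y | ∃ n, f^[n] y ∈ Metric.ball p ρ}) :
    ∃ n, f^[n] z ∈ Metric.ball p ρ := by
  obtain ⟨W, hW, hzW, hnorm⟩ := hz
  obtain ⟨φ, hφ, g, hg⟩ := hnorm (fun n y => ((f^[n] y : ℂ) : OnePoint ℂ)) fun n => ⟨n, rfl⟩
  let _ : UniformSpace (OnePoint ℂ) := uniformSpaceOfCompactR1
  have hg' : TendstoLocallyUniformlyOn
    (fun k y => ((f^[φ k] y : ℂ) : OnePoint ℂ)) g atTop W := hg
  have hgp : ∀ y ∈ W, (∃ n, f^[n] y ∈ Metric.ball p ρ) → g y = p := by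
    rintro y hy ⟨n, hn⟩
    suffices h : Tendsto (fun k => f^[k] y) atTop (𝓝 p) from
      tendsto_nhds_unique (hg'.tendsto_at hy)
        ((OnePoint.continuous_coe.tendsto p).comp (h.comp hφ.tendsto_atTop))
    rw [← tendsto_add_atTop_iff_nat n, tendsto_iff_dist_tendsto_zero]
    have hlim := (tendsto_pow_atTop_nhds_zero_of_lt_one (r := (1 / 2 : ℝ)) (by norm_num)
      (by norm_num)).mul_const ρ
    rw [zero_mul] at hlim
    refine squeeze_zero (fun _ => dist_nonneg) (fun k => ?_) hlim
    rw [Function.iterate_add_apply]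
    exact (dist_iterate_le hf hn k).2
  have hgz : g z = p := by
    by_contra hne
    have hgc : ContinuousOn g W := hg'.continuousOn (Eventually.frequently
      (Eventually.of_forall fun k => (OnePoint.continuous_coe.comp
        (hfc.iterate (φ k))).continuousOn))
    have hev : ∀ᶠ y in 𝓝 z, y ∈ W ∧ g y ≠ p := (hW.eventually_mem hzW).and
      ((hgc.continuousAt (hW.mem_nhds hzW)).eventually_ne hne)
    obtain ⟨y, hy, hyW, hyne⟩ := ((mem_closure_iff_frequently.1 hcl).and_eventually hev).exists
    exact hyne (hgp y hyW hy)
  have hlim := hg'.tendsto_at hzW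
  rw [hgz] at hlim
  have hlim' : Tendsto (fun k => f^[φ k] z) atTop (𝓝 p) :=
    OnePoint.isOpenEmbedding_coe.isInducing.tendsto_nhds_iff.2 hlim
  obtain ⟨k, hk⟩ := (hlim'.eventually (Metric.ball_mem_nhds p hρ)).exists
  exact ⟨φ k, hk⟩

lemma isOpen_setOf_exists_iterate_mem_ball (hfc : Continuous f) :
    IsOpen {y | ∃ n, f^[n] y ∈ Metric.ball p ρ} := by
  simp only [ofPred_exists]
  exact isOpen_iUnion fun n => Metric.isOpen_ball.preimage (hfc.iterate n)

/-- If `f` maps the boundary of `G` off the closure of `G`, the Fatou component of an attracting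
fixed point `p ∈ G` stays inside `G`: the component `V` at `p` of the set of points that reach the
trap disc without leaving `G` has no boundary point in the basin of `p`, because the orbit of such
a point would stay in `closure G`, hence in `G`. -/
theorem exists_isInvariantFatouComponent (hfc : Continuous f) (hρ : 0 < ρ)
    (hf : ∀ z ∈ Metric.ball p ρ, dist (f z) p ≤ 1 / 2 * dist z p) {K G : Set ℂ} (hG : IsOpen G)
    (hKG : K ⊆ G) (hK : IsPreconnected K) (hpK : Metric.ball p ρ ⊆ K)
    (hfK : MapsTo f K (Metric.ball p ρ)) (hfG : ∀ z ∈ frontier G, f z ∉ closure G) :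
    ∃ U, IsInvariantFatouComponent f U ∧ K ⊆ U ∧ U ⊆ G := by
  have hpb : p ∈ Metric.ball p ρ := Metric.mem_ball_self hρ
  have hbG : Metric.ball p ρ ⊆ G := hpK.trans hKG
  have hfb : MapsTo f (Metric.ball p ρ) (Metric.ball p ρ) := hfK.mono_left hpK
  have hfp : f p = p := by
    have := hf p hpb
    rw [dist_self, mul_zero] at this
    exact dist_le_zero.1 this
  set B : Set ℂ := {z | ∃ n, (∀ j ≤ n, f^[j] z ∈ G) ∧ f^[n] z ∈ Metric.ball p ρ} with hB
  set A : Set ℂ := {z | ∃ n, f^[n] z ∈ Metric.ball p ρ} with hA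
  have hAo : IsOpen A := isOpen_setOf_exists_iterate_mem_ball hfc
  have hAF : A ⊆ fatouSet f := fun z ⟨n, hn⟩ =>
    subset_fatouSet_of_mapsTo_ball hf (Metric.isOpen_ball.preimage (hfc.iterate n))
      (fun _ h => h) hn
  have hBA : B ⊆ A := fun z ⟨n, _, hn⟩ => ⟨n, hn⟩
  have hBo : IsOpen B := by
    have : B = ⋃ n, ((⋂ j ∈ Finset.Iic n, f^[j] ⁻¹' G) ∩ f^[n] ⁻¹' Metric.ball p ρ) := by
      ext z
      simp [hB]
    rw [this]
    exact isOpen_iUnion fun n => (isOpen_biInter_finset fun j _ =>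
      hG.preimage (hfc.iterate j)).inter (Metric.isOpen_ball.preimage (hfc.iterate n))
  have hBG : B ⊆ G := fun z ⟨n, hn, _⟩ => hn 0 (Nat.zero_le n)
  have hfB : MapsTo f B B := by
    rintro z ⟨n, hn, hnb⟩
    rcases n with _ | n
    · exact ⟨0, fun j hj => by
        rw [Nat.le_zero.1 hj]
        exact hbG (hfb hnb), hfb hnb⟩
    · exact ⟨n, fun j hj => hn (j + 1) (Nat.succ_le_succ hj), hnb⟩
  have hKB : K ⊆ B := fun z hz => ⟨1, fun j hj => by
    rcases Nat.le_one_iff_eq_zero_or_eq_one.1 hj with rfl | rfl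
    exacts [hKG hz, hbG (hfK hz)], hfK hz⟩
  have hpB : p ∈ B := hKB (hpK hpb)
  set V := connectedComponentIn B p with hV
  set U := connectedComponentIn (fatouSet f) p with hU
  have hpV : p ∈ V := mem_connectedComponentIn hpB
  have hVo : IsOpen V := hBo.connectedComponentIn
  have hVB : V ⊆ B := connectedComponentIn_subset B p
  have hfV : MapsTo f V V := by
    refine mapsTo_iff_image_subset.2 ?_
    refine (isPreconnected_connectedComponentIn.image f
      hfc.continuousOn).subset_connectedComponentIn ⟨p, hpV, hfp⟩ ?_
    exact (hfB.mono_left hVB).image_subset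
  have hVU : V ⊆ U := isPreconnected_connectedComponentIn.subset_connectedComponentIn hpV
    (hVB.trans (hBA.trans hAF))
  have hpF : p ∈ fatouSet f := hAF (hBA hpB)
  have hUF : U ⊆ fatouSet f := connectedComponentIn_subset _ p
  have hUA : U ⊆ A := isPreconnected_connectedComponentIn.subset_of_closure_inter_subset hAo
    ⟨p, mem_connectedComponentIn hpF, hBA hpB⟩
    fun z hz => exists_iterate_mem_ball_of_mem_fatouSet hfc hρ hf (hUF hz.2) hz.1
  have hUV : U ⊆ V := by
    refine isPreconnected_connectedComponentIn.subset_of_closure_inter_subset hVo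
      ⟨p, mem_connectedComponentIn hpF, hpV⟩ ?_
    rintro z ⟨hzV, hzU⟩
    have horb : ∀ n, f^[n] z ∈ closure G := fun n =>
      closure_mono (hVB.trans hBG) ((hfV.iterate n).closure (hfc.iterate n) hzV)
    have horb' : ∀ n, f^[n] z ∈ G := by
      intro n
      by_contra hn
      refine hfG (f^[n] z) (hG.frontier_eq ▸ ⟨horb n, hn⟩) ?_
      rw [← Function.iterate_succ_apply' f]
      exact horb (n + 1)
    obtain ⟨n, hn⟩ := hUA hzU
    have hzB : z ∈ B := ⟨n, fun j _ => horb' j, hn⟩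
    have hins : IsPreconnected (insert z V) :=
      isPreconnected_connectedComponentIn.subset_closure (subset_insert z V)
        (insert_subset hzV subset_closure)
    exact hins.subset_connectedComponentIn (mem_insert_of_mem z hpV)
      (insert_subset hzB hVB) (mem_insert z V)
  have hUV' : U = V := hUV.antisymm hVU
  refine ⟨U, ⟨⟨p, hpF, rfl⟩, hUV' ▸ hfV⟩, ?_, ?_⟩
  · rw [hUV']
    exact hK.subset_connectedComponentIn (hpK hpb) hKB
  · exact hUV.trans (hVB.trans hBG)

end Dynamics

/-! ### Construction of the entire function -/

lemma IsOpen.exists_isCompact_isPreconnected_superset {D C : Set ℂ} (hD : IsOpen D)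
    (hpc : IsPathConnected D) (hC : IsCompact C) (hCD : C ⊆ D) :
    ∃ K, IsCompact K ∧ IsPreconnected K ∧ C ⊆ K ∧ K ⊆ D := by
  obtain ⟨p, hp, hpj⟩ := hpc
  have hr : ∀ x ∈ C, ∃ r, 0 < r ∧ Metric.closedBall x r ⊆ D := fun x hx =>
    Metric.nhds_basis_closedBall.mem_iff.1 (hD.mem_nhds (hCD hx))
  choose! r hr0 hrD using hr
  have hγ : ∀ x ∈ C, ∃ γ : Set ℂ, IsCompact γ ∧ IsPreconnected γ ∧ p ∈ γ ∧ x ∈ γ ∧ γ ⊆ D := by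
    intro x hx
    obtain ⟨γ, hγ⟩ := hpj (hCD hx)
    exact ⟨range γ, isCompact_range γ.continuous, isPreconnected_range γ.continuous,
      γ.source_mem_range, γ.target_mem_range, range_subset_iff.2 hγ⟩
  choose! γ hγc hγp hpγ hxγ hγD using hγ
  obtain ⟨t, htC, ht⟩ := hC.elim_nhds_subcover (fun x => Metric.closedBall x (r x))
    fun x hx => Metric.closedBall_mem_nhds x (hr0 x hx)
  refine ⟨⋃ x ∈ t, (γ x ∪ Metric.closedBall x (r x)), ?_, ?_, ?_, ?_⟩
  · exact t.isCompact_biUnion fun x hx =>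
      (hγc x (htC x hx)).union (isCompact_closedBall x (r x))
  · refine isPreconnected_of_forall p fun y hy => ?_
    obtain ⟨x, hx, hyx⟩ := mem_iUnion₂.1 hy
    exact ⟨_, subset_biUnion_of_mem (u := fun x => γ x ∪ Metric.closedBall x (r x)) hx,
      Or.inl (hpγ x (htC x hx)), hyx, (hγp x (htC x hx)).union x (hxγ x (htC x hx))
        (Metric.mem_closedBall_self (hr0 x (htC x hx)).le)
        (convex_closedBall x (r x)).isPreconnected⟩
  · intro y hy
    obtain ⟨x, hx, hyx⟩ := mem_iUnion₂.1 (ht hy)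
    exact mem_iUnion₂.2 ⟨x, hx, Or.inr hyx⟩
  · exact iUnion₂_subset fun x hx => union_subset (hγD x (htC x hx)) (hrD x (htC x hx))

lemma exp_ne_polynomial (P : Polynomial ℂ) : ¬ ∀ z, Complex.exp z = P.eval z := by
  intro h
  -- By periodicity `P - 1` vanishes at all multiples of `2πi`.
  have h1 : P = 1 := by
    refine Polynomial.eq_of_infinite_eval_eq P 1 ?_
    refine (Set.infinite_range_of_injective
      (f := fun n : ℕ => (n : ℂ) * (2 * Real.pi * Complex.I)) ?_).mono ?_
    · intro a b hab
      have := mul_right_cancel₀ Complex.two_pi_I_ne_zero hab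
      exact_mod_cast this
    · rintro _ ⟨n, rfl⟩
      simp [← h, Complex.exp_nat_mul_two_pi_mul_I]
  have h2 := h (Complex.log 2)
  rw [Complex.exp_log two_ne_zero, h1, Polynomial.eval_one] at h2
  norm_num at h2

theorem theorem1p2 (D : Set ℂ) (hopen : IsOpen D) (hbdd : Bornology.IsBounded D)
    (hsc : IsSimplyConnected D) (hreg : interior (closure D) = D) (δ : ℝ) (hδ : 0 < δ) :
    ∃ f : ℂ → ℂ, IsTranscendentalEntire f ∧
      ∃ U : Set ℂ, IsInvariantFatouComponent f U ∧ innerSet D δ ⊆ U ∧ U ⊆ D := by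
  obtain ⟨p, hp⟩ := hsc.nonempty
  obtain ⟨ρ, hρ, hρD⟩ := Metric.nhds_basis_closedBall.mem_iff.1 (hopen.mem_nhds hp)
  have hinner : IsCompact (closure D ∩ {z | δ ≤ Metric.infDist z Dᶜ}) :=
    (hbdd.isCompact_closure).inter_right
      (isClosed_le continuous_const (Metric.continuous_infDist_pt _))
  have hinnerD : closure D ∩ {z | δ ≤ Metric.infDist z Dᶜ} ⊆ D := by
    rintro z ⟨-, hz⟩
    by_contra hzD
    have h0 := Metric.infDist_zero_of_mem (show z ∈ Dᶜ from hzD)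
    have hz' : δ ≤ Metric.infDist z Dᶜ := hz
    linarith
  obtain ⟨K, hK, hKp, hCK, hKD⟩ := hopen.exists_isCompact_isPreconnected_superset
    hsc.isPathConnected (hinner.union (isCompact_closedBall p ρ)) (union_subset hinnerD hρD)
  have hbK : Metric.ball p ρ ⊆ K :=
    Metric.ball_subset_closedBall.trans (subset_union_right.trans hCK)
  have hpK : p ∈ K := hbK (Metric.mem_ball_self hρ)
  obtain ⟨G, hG, hHG, hGD, hGc⟩ := exists_open_between_and_isCompact_closure
    (isCompact_polynomialHull hK) hopen (polynomialHull_subset_of_isSimplyConnected hopen hsc hK hKD)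
  have hKG : K ⊆ G := (subset_polynomialHull K).trans hHG
  have hfrG : frontier G ⊆ closure G := frontier_subset_closure
  have hdisj : Disjoint (frontier G) (polynomialHull K) := by
    rw [hG.frontier_eq]
    exact disjoint_sdiff_left.mono_right hHG
  -- On `K` the polynomial part of `f - p` is at most `ρ / 4` and the exponential part at most
  -- `ρ / 8`; the bound for `q` on the boundary of `G` makes `f` leave the disc of radius `R`.
  obtain ⟨R, hR⟩ := (Metric.isBounded_iff_subset_closedBall p).1 hGc.isBounded
  obtain ⟨E, hE⟩ := hGc.exists_bound_of_continuousOn (f := fun z => Complex.exp z - Complex.exp p)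
    (by fun_prop)
  have hE0 : 0 ≤ E := (norm_nonneg _).trans (hE p (subset_closure (hKG hpK)))
  obtain ⟨q, hqK, hqL⟩ := exists_polynomial_norm_le_one_and_le_norm hK
    (infinite_of_mem_nhds p (mem_of_superset (Metric.ball_mem_nhds p hρ) hbK))
    (hGc.of_isClosed_subset isClosed_frontier hfrG) hdisj (1 + (R + ρ) / (ρ / 8))
  set η : ℝ := ρ / 8 with hη
  have hη0 : 0 < η := by positivity
  set τ : ℝ := η / (E + 1) with hτ
  have hτ0 : 0 < τ := by positivity
  have hτE : τ * E ≤ η := by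
    rw [hτ, div_mul_eq_mul_div, div_le_iff₀ (by positivity)]
    nlinarith
  set f : ℂ → ℂ := fun z => p + (η * (q.eval z - q.eval p)
    + τ * (Complex.exp z - Complex.exp p)) with hf
  have hfd : Differentiable ℂ f := by fun_prop
  have hfp : f p = p := by simp [hf]
  have hexp : ∀ z ∈ closure G, ‖(τ : ℂ) * (Complex.exp z - Complex.exp p)‖ ≤ η := by
    intro z hz
    rw [norm_mul, Complex.norm_real, Real.norm_of_nonneg hτ0.le]
    exact (mul_le_mul_of_nonneg_left (hE z hz) hτ0.le).trans hτE
  have hfK : ∀ z ∈ K, dist (f z) p ≤ ρ / 2 := by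
    intro z hz
    have h1 : ‖(η : ℂ) * (q.eval z - q.eval p)‖ ≤ η * 2 := by
      rw [norm_mul, Complex.norm_real, Real.norm_of_nonneg hη0.le]
      gcongr
      linarith [norm_sub_le (q.eval z) (q.eval p), hqK z hz, hqK p hpK]
    rw [dist_eq_norm, hf, add_sub_cancel_left]
    linarith [norm_add_le ((η : ℂ) * (q.eval z - q.eval p))
      (τ * (Complex.exp z - Complex.exp p)), hexp z (subset_closure (hKG hz))]
  have hfL : ∀ z ∈ frontier G, f z ∉ closure G := by
    intro z hz hfz
    have h1 : R + ρ ≤ ‖(η : ℂ) * (q.eval z - q.eval p)‖ := by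
      rw [norm_mul, Complex.norm_real, Real.norm_of_nonneg hη0.le, ← div_le_iff₀' hη0]
      linarith [norm_sub_norm_le (q.eval z) (q.eval p), hqL z hz, hqK p hpK]
    have h2 : dist (f z) p ≤ R := hR hfz
    rw [dist_eq_norm, hf, add_sub_cancel_left] at h2
    have h3 := norm_sub_le ((η : ℂ) * (q.eval z - q.eval p)
      + τ * (Complex.exp z - Complex.exp p)) (τ * (Complex.exp z - Complex.exp p))
    rw [add_sub_cancel_right] at h3
    linarith [hexp z (hfrG hz)]
  have hcontr : ∀ z ∈ Metric.ball p ρ, dist (f z) p ≤ 1 / 2 * dist z p := by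
    intro z hz
    have h := Complex.dist_le_div_mul_dist_of_mapsTo_ball hfd.differentiableOn
      (R₂ := ρ / 2) (fun w hw => by rw [hfp]; exact hfK w (hbK hw)) hz
    rwa [hfp, div_right_comm, div_self hρ.ne'] at h
  obtain ⟨U, hU, hKU, hUG⟩ := exists_isInvariantFatouComponent hfd.continuous hρ hcontr hG hKG
    hKp hbK (fun z hz => Metric.mem_ball.2 ((hfK z hz).trans_lt (half_lt_self hρ))) hfL
  refine ⟨f, ⟨hfd, ?_⟩, U, hU, fun z hz => hKU (hCK (Or.inl ⟨subset_closure hz.1, hz.2.le⟩)),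
    hUG.trans (subset_closure.trans hGD)⟩
  rintro ⟨P, hP⟩
  refine exp_ne_polynomial (Polynomial.C (Complex.exp p) + Polynomial.C ((τ : ℂ)⁻¹) *
    (P - Polynomial.C p - Polynomial.C (η : ℂ) * (q - Polynomial.C (q.eval p)))) fun z => ?_
  have hτ' : (τ : ℂ) ≠ 0 := by exact_mod_cast hτ0.ne'
  simp only [Polynomial.eval_add, Polynomial.eval_mul, Polynomial.eval_sub, Polynomial.eval_C,
    ← hP, hf]
  field_simp
  ring
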